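/- Let $\ell\ge 1$ and $m\ge 2$ be integers, set $n=\ell m-1$, and let $\sigma>0$. Let $a_0,\dots,a_n,b_0,\dots,b_n$ be real random variables such that $a_0,\dots,a_{\ell-1},b_0,\dots,b_{\ell-1}$ are independent and identically distributed with the Gaussian law $\mathcal N(0,\sigma^2)$, and such that both sequences of coefficients are $\ell$-periodic, i.e. $a_{i+\ell}=a_i$ and $b_{i+\ell}=b_i$ for all $0\le i\le n-\ell$. Let $$T_n(x)=\sum_{j=0}^{n}\bigl(a_j\cos(jx)+b_j\sin(jx)\bigr),\qquad x\in(0,2\pi),$$ and let $N_n(0,2\pi)$ be the number of distinct zeros of $T_n$ in the open interval $(0,2\pi)$. Then $$\mathbb E[N_n(0,2\pi)]=n+1-\ell+\sqrt{n^2+\frac{\ell^2-1}{3}}.$$ -/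

import Mathlib

open scoped ENNReal NNReal

/-- The trigonometric polynomial `T_n(x) = ∑_{j=0}^n (a_j cos (j x) + b_j sin (j x))`. -/
noncomputable def trigPoly (n : ℕ) (a b : ℕ → ℝ) (x : ℝ) : ℝ :=
  ∑ j ∈ Finset.range (n + 1), (a j * Real.cos (j * x) + b j * Real.sin (j * x))

/-- The coefficients `a_0, …, a_n` are `ℓ`-periodic: `a_{i+ℓ} = a_i` for `0 ≤ i ≤ n - ℓ`. -/
def IsPeriodicCoeffs (ℓ n : ℕ) (a : ℕ → ℝ) : Prop :=
  ∀ i : ℕ, i + ℓ ≤ n → a (i + ℓ) = a i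

/-- The number of (distinct) zeros of `f` in the set `S`, with value `∞` if there are infinitely
many. -/
noncomputable def numZeros (f : ℝ → ℝ) (S : Set ℝ) : ℝ≥0∞ :=
  ({x ∈ S | f x = 0}.encard : ℝ≥0∞)

/-! Split each index as `ℓ * k + j` and sum over `k`: periodicity turns `T_n` into a Dirichlet
kernel times a sum `G` over only `ℓ` frequencies, `sin(ℓx/2) T_n(x) = sin(mℓx/2) G(x)`
(`sin_mul_trigPoly`). The kernel has `ℓm - ℓ = n + 1 - ℓ` deterministic zeros, and almost surely `G`
vanishes at none of them, so the two counts add (`numZeros_trigPoly_eq`).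

`G` is a stationary Gaussian process. Its zeros are counted without a Kac-Rice formula, as the
increasing limit of sign changes along dyadic grids (`numZeros_eq_iSup_signChanges`); this needs `G`
nonzero on the grid and without multiple zeros, both almost sure (`ae_forall_trigVecDeriv_ne_zero`).
By Sheppard's formula (`piGaussian_mul_neg`) a sign change over a step `h` has probability `θ(h)/π`,
where `θ(h)/h` tends to the root mean square frequency. Monotone convergence gives
`lintegral_numZeros_trigVec`. The frequencies `j + (m - 1)ℓ/2` have mean `n/2` and variance `(ℓ² -
1)/12`, whence the square root in the result. -/

section

open MeasureTheory ProbabilityTheory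

/-! ### Linear forms in independent Gaussian variables. -/

section GaussianLinear

variable {ι : Type*} [Fintype ι] (v : ℝ≥0)

/-- The law of a family of independent centred Gaussian variables of variance `v`. -/
noncomputable abbrev piGaussian (ι : Type*) [Fintype ι] (v : ℝ≥0) : Measure (ι → ℝ) :=
  Measure.pi (fun _ : ι => gaussianReal 0 v)

theorem hasLaw_eval_piGaussian (i : ι) :
    HasLaw (fun w : ι → ℝ => w i) (gaussianReal 0 v) (piGaussian ι v) :=
  ⟨(measurable_pi_apply i).aemeasurable,
    (measurePreserving_eval (fun _ : ι => gaussianReal 0 v) i).map_eq⟩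

theorem hasGaussianLaw_piGaussian : HasGaussianLaw (fun w : ι → ℝ => w) (piGaussian ι v) := by
  have h : iIndepFun (fun (i : ι) (w : ι → ℝ) => w i) (piGaussian ι v) :=
    iIndepFun_pi (X := fun _ x => x) (fun _ => aemeasurable_id)
  exact h.hasGaussianLaw fun i => (hasLaw_eval_piGaussian v i).hasGaussianLaw

theorem hasGaussianLaw_dotProduct_pair (c d : ι → ℝ) :
    HasGaussianLaw (fun w : ι → ℝ => (c ⬝ᵥ w, d ⬝ᵥ w)) (piGaussian ι v) := by
  have h := (hasGaussianLaw_piGaussian (ι := ι) v).map_fun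
    (((dotProductBilin ℝ ℝ c).prod (dotProductBilin ℝ ℝ d)).toContinuousLinearMap)
  exact h

theorem memLp_eval_piGaussian (i : ι) : MemLp (fun w : ι → ℝ => w i) 2 (piGaussian ι v) :=
  (hasLaw_eval_piGaussian v i).hasGaussianLaw.memLp_two

theorem covariance_eval_piGaussian [DecidableEq ι] (i j : ι) :
    cov[fun w : ι → ℝ => w i, fun w => w j; piGaussian ι v] = if i = j then (v : ℝ) else 0 := by
  split_ifs with h
  · subst h
    rw [covariance_self (measurable_pi_apply i).aemeasurable, (hasLaw_eval_piGaussian v i).variance_eq]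
    simp
  · have h' : iIndepFun (fun (i : ι) (w : ι → ℝ) => w i) (piGaussian ι v) :=
      iIndepFun_pi (X := fun _ x => x) (fun _ => aemeasurable_id)
    exact (h'.indepFun h).covariance_eq_zero (memLp_eval_piGaussian v i)
      (memLp_eval_piGaussian v j)

theorem covariance_dotProduct_piGaussian (c d : ι → ℝ) :
    cov[fun w : ι → ℝ => c ⬝ᵥ w, fun w => d ⬝ᵥ w; piGaussian ι v] = v * (c ⬝ᵥ d) := by
  classical
  simp only [dotProduct]
  rw [covariance_fun_sum_fun_sum (fun i => (memLp_eval_piGaussian v i).const_mul _)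
    (fun i => (memLp_eval_piGaussian v i).const_mul _)]
  simp only [covariance_const_mul_left, covariance_const_mul_right, covariance_eval_piGaussian]
  simp [Finset.mul_sum]
  refine Finset.sum_congr rfl fun i _ => by ring

theorem hasLaw_dotProduct_piGaussian (c : ι → ℝ) :
    HasLaw (fun w : ι → ℝ => c ⬝ᵥ w) (gaussianReal 0 (v * (c ⬝ᵥ c).toNNReal))
      (piGaussian ι v) := by
  have h := (hasGaussianLaw_dotProduct_pair v c c).fst
  refine ⟨h.aemeasurable, ?_⟩
  have hc : 0 ≤ c ⬝ᵥ c := Finset.sum_nonneg fun i _ => mul_self_nonneg _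
  rw [h.map_eq_gaussianReal]
  congr 1
  · simp only [dotProduct]
    rw [integral_finsetSum _ fun i _ =>
      ((memLp_eval_piGaussian v i).integrable (by norm_num)).const_mul _]
    refine Finset.sum_eq_zero fun i _ => ?_
    rw [integral_const_mul, (hasLaw_eval_piGaussian v i).integral_eq]
    simp
  · rw [← covariance_self h.aemeasurable, covariance_dotProduct_piGaussian,
      Real.toNNReal_mul v.coe_nonneg]
    simp

theorem ae_dotProduct_ne_zero {v : ℝ≥0} (hv : v ≠ 0) {c : ι → ℝ} (hc : 0 < c ⬝ᵥ c) :
    ∀ᵐ w ∂piGaussian ι v, c ⬝ᵥ w ≠ 0 := by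
  have h := hasLaw_dotProduct_piGaussian v c
  have h0 : v * (c ⬝ᵥ c).toNNReal ≠ 0 := mul_ne_zero hv (by simpa using hc)
  have := nullSingletonClass_gaussianReal (μ := 0) h0
  rw [h.ae_iff (p := fun x => x ≠ 0) (measurableSet_setOfPred.1 (measurableSet_singleton 0).compl)]
  rw [ae_iff]
  simp

/-- Uncorrelated linear forms of equal variance are a pair of independent Gaussian variables. -/
theorem hasLaw_prod_dotProduct {L : ℝ} {c d : ι → ℝ} (hc : c ⬝ᵥ c = L) (hd : d ⬝ᵥ d = L)
    (hcd : c ⬝ᵥ d = 0) :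
    HasLaw (fun w : ι → ℝ => (c ⬝ᵥ w, d ⬝ᵥ w))
      ((gaussianReal 0 (v * L.toNNReal)).prod (gaussianReal 0 (v * L.toNNReal)))
      (piGaussian ι v) := by
  have h := hasGaussianLaw_dotProduct_pair v c d
  have hi := h.indepFun_of_covariance_eq_zero (by rw [covariance_dotProduct_piGaussian, hcd, mul_zero])
  refine ⟨h.aemeasurable, ?_⟩
  rw [(indepFun_iff_map_prod_eq_prod_map_map h.fst.aemeasurable h.snd.aemeasurable).1 hi,
    (hasLaw_dotProduct_piGaussian v c).map_eq, (hasLaw_dotProduct_piGaussian v d).map_eq, hc, hd]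

/-- Lebesgue measure has the nowhere zero density `∏ (gaussianPDF)⁻¹` with respect to the Gaussian
one, so its null sets are Gaussian null. This lets Bulinskaya's lemma be proved for Lebesgue
measure. -/
theorem piGaussian_absolutelyContinuous {v : ℝ≥0} (hv : v ≠ 0) :
    piGaussian ι v ≪ volume := by
  have key : (volume : Measure (ι → ℝ)) =
      (piGaussian ι v).withDensity (fun w => ∏ i, (gaussianPDF 0 v (w i))⁻¹) := by
    rw [volume_pi]
    refine Measure.pi_eq fun s hs => ?_
    rw [withDensity_apply _ (MeasurableSet.univ_pi hs),
      ← lintegral_indicator (MeasurableSet.univ_pi hs)]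
    have h1 : ∀ w : ι → ℝ, (Set.univ.pi s).indicator
        (fun w => ∏ i, (gaussianPDF 0 v (w i))⁻¹) w
        = ∏ i, (s i).indicator (fun x => (gaussianPDF 0 v x)⁻¹) (w i) := by
      intro w
      by_cases h : w ∈ Set.univ.pi s
      · rw [Set.indicator_of_mem h]
        exact Finset.prod_congr rfl fun i _ =>
          (Set.indicator_of_mem (h i trivial) (fun x => (gaussianPDF 0 v x)⁻¹)).symm
      · rw [Set.indicator_of_notMem h]
        simp only [Set.mem_pi, Set.mem_univ, true_imp_iff, not_forall] at h
        obtain ⟨i, hi⟩ := h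
        exact (Finset.prod_eq_zero (Finset.mem_univ i) (Set.indicator_of_notMem hi _)).symm
    have hm : ∀ i, Measurable ((s i).indicator (fun x => (gaussianPDF 0 v x)⁻¹)) := fun i =>
      (measurable_gaussianPDF 0 v).inv.indicator (hs i)
    simp_rw [h1]
    rw [lintegral_prod_eq_prod_lintegral_of_indepFun Finset.univ
      (fun i (w : ι → ℝ) => (s i).indicator (fun x => (gaussianPDF 0 v x)⁻¹) (w i))
      (iIndepFun_pi fun i => (hm i).aemeasurable) (fun i => (hm i).comp (measurable_pi_apply i))]
    refine Finset.prod_congr rfl fun i _ => ?_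
    rw [(hasLaw_eval_piGaussian v i).lintegral_comp (hm i).aemeasurable,
      gaussianReal_of_var_ne_zero _ hv,
      lintegral_withDensity_eq_lintegral_mul _ (measurable_gaussianPDF 0 v) (hm i),
      ← lintegral_indicator_one (hs i)]
    refine lintegral_congr fun x => ?_
    by_cases hx : x ∈ s i
    · simp [hx, ENNReal.mul_inv_cancel (gaussianPDF_pos 0 hv x).ne' gaussianPDF_ne_top]
    · simp [hx]
  rw [key]
  refine withDensity_absolutelyContinuous' ?_ (Filter.Eventually.of_forall fun w => ?_)
  · exact (Finset.measurable_fun_prod _ fun i _ =>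
      ((measurable_gaussianPDF 0 v).comp (measurable_pi_apply i)).inv).aemeasurable
  · exact Finset.prod_ne_zero_iff.2 fun i _ => ENNReal.inv_ne_zero.2 gaussianPDF_ne_top

end GaussianLinear

/-! ### Sheppard's formula, by rotation invariance in the plane. -/

section Sheppard

theorem gaussianPDF_mul_polar (v : ℝ≥0) (r α : ℝ) :
    gaussianPDF 0 v (r * Real.cos α) * gaussianPDF 0 v (r * Real.sin α)
      = gaussianPDF 0 v r * gaussianPDF 0 v 0 := by
  simp only [gaussianPDF]
  rw [← ENNReal.ofReal_mul (gaussianPDFReal_nonneg _ _ _),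
    ← ENNReal.ofReal_mul (gaussianPDFReal_nonneg _ _ _)]
  congr 1
  simp only [gaussianPDFReal, sub_zero]
  rw [mul_mul_mul_comm, ← Real.exp_add]
  conv_rhs => rw [mul_mul_mul_comm, ← Real.exp_add]
  congr 2
  have := Real.sin_sq_add_cos_sq α
  rw [← add_div, ← add_div]
  congr 1
  linear_combination r ^ 2 * (-this)

/-- The mass of a cone under the planar Gaussian measure is proportional to its opening. -/
theorem gaussianReal_prod_cone {v : ℝ≥0} (hv : v ≠ 0) {S : Set (ℝ × ℝ)} (hS : MeasurableSet S)
    {E : Set ℝ} (hE : MeasurableSet E)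
    (hSE : ∀ r > 0, ∀ α ∈ Set.Ioo (-Real.pi) Real.pi,
      ((r * Real.cos α, r * Real.sin α) ∈ S ↔ α ∈ E)) :
    ((gaussianReal 0 v).prod (gaussianReal 0 v)) S
      = volume (E ∩ Set.Ioo (-Real.pi) Real.pi) / ENNReal.ofReal (2 * Real.pi) := by
  have main : ∀ {S : Set (ℝ × ℝ)} (_ : MeasurableSet S) {E : Set ℝ} (_ : MeasurableSet E)
      (_ : ∀ r > 0, ∀ α ∈ Set.Ioo (-Real.pi) Real.pi,
        ((r * Real.cos α, r * Real.sin α) ∈ S ↔ α ∈ E)),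
      ((gaussianReal 0 v).prod (gaussianReal 0 v)) S
        = (∫⁻ r in Set.Ioi (0 : ℝ), ENNReal.ofReal r * (gaussianPDF 0 v r * gaussianPDF 0 v 0))
          * volume (E ∩ Set.Ioo (-Real.pi) Real.pi) := by
    intro S hS E hE hSE
    rw [gaussianReal_of_var_ne_zero _ hv, prod_withDensity (measurable_gaussianPDF 0 v)
      (measurable_gaussianPDF 0 v), withDensity_apply _ hS, ← lintegral_indicator hS,
      ← Measure.volume_eq_prod, ← lintegral_comp_polarCoord_symm]
    have hm1 : Measurable fun r : ℝ =>
        ENNReal.ofReal r * (gaussianPDF 0 v r * gaussianPDF 0 v 0) :=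
      ENNReal.measurable_ofReal.mul ((measurable_gaussianPDF 0 v).mul_const _)
    have hm2 : Measurable (E.indicator (fun _ : ℝ => (1 : ℝ≥0∞))) :=
      measurable_const.indicator hE
    have h2 : volume (E ∩ Set.Ioo (-Real.pi) Real.pi)
        = ∫⁻ α in Set.Ioo (-Real.pi) Real.pi, E.indicator (fun _ => (1 : ℝ≥0∞)) α := by
      rw [lintegral_indicator_const hE, one_mul, Measure.restrict_apply hE]
    rw [h2, ← lintegral_prod_mul hm1.aemeasurable hm2.aemeasurable, Measure.prod_restrict]
    refine setLIntegral_congr_fun (measurableSet_Ioi.prod measurableSet_Ioo) ?_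
    rintro ⟨r, α⟩ ⟨hr, hα⟩
    simp only [polarCoord_symm_apply, smul_eq_mul]
    have := hSE r hr α hα
    rw [mul_assoc]
    congr 1
    by_cases h : α ∈ E
    · rw [Set.indicator_of_mem (this.2 h), Set.indicator_of_mem h, mul_one,
        gaussianPDF_mul_polar]
    · rw [Set.indicator_of_notMem (fun h' => h (this.1 h')), Set.indicator_of_notMem h, mul_zero]
  -- The whole plane has mass one, which fixes the radial integral without computing it.
  have h1 := main MeasurableSet.univ MeasurableSet.univ (fun _ _ _ _ => by simp)
  rw [main hS hE hSE]
  rw [measure_univ, Set.univ_inter, Real.volume_Ioo, sub_neg_eq_add, ← two_mul] at h1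
  have hpi := Real.pi_pos
  rw [ENNReal.eq_inv_of_mul_eq_one_left h1.symm, ENNReal.div_eq_inv_mul]

/-- The half-planes around the directions `0` and `θ` disagree on two opposite sectors of opening
`θ`; their total `2θ` out of `2π` gives the probability `θ / π`. -/
theorem cos_mul_cos_sub_neg_iff {θ α : ℝ} (h0 : 0 < θ) (h1 : θ < Real.pi / 2)
    (hα : α ∈ Set.Ioo (-Real.pi) Real.pi) :
    Real.cos α * Real.cos (α - θ) < 0 ↔
      α ∈ Set.Ioo (-(Real.pi / 2)) (-(Real.pi / 2) + θ) ∪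
        Set.Ioo (Real.pi / 2) (Real.pi / 2 + θ) := by
  have hneg : ∀ x, Real.pi / 2 < x → x < Real.pi + Real.pi / 2 → Real.cos x < 0 := fun x a b =>
    Real.cos_neg_of_pi_div_two_lt_of_lt a b
  have hneg' : ∀ x, x < -(Real.pi / 2) → -(Real.pi + Real.pi / 2) < x → Real.cos x < 0 :=
    fun x a b => by
      rw [← Real.cos_neg]; exact hneg _ (by linarith) (by linarith)
  obtain ⟨ha, hb⟩ := hα
  simp only [Set.mem_union, Set.mem_Ioo]
  constructor
  · intro h
    by_contra hcon
    push Not at hcon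
    obtain ⟨hc1, hc2⟩ := hcon
    refine absurd h (not_lt.2 ?_)
    rcases le_or_gt α (-(Real.pi / 2)) with h3 | h3
    · refine mul_nonneg_of_nonpos_of_nonpos ?_ ?_
      · rw [← Real.cos_neg]
        exact Real.cos_nonpos_of_pi_div_two_le_of_le (by linarith) (by linarith)
      · exact (hneg' _ (by linarith) (by linarith)).le
    · have h4 := hc1 h3
      rcases le_or_gt α (Real.pi / 2) with h5 | h5
      · exact mul_nonneg (Real.cos_nonneg_of_mem_Icc ⟨by linarith, by linarith⟩)
          (Real.cos_nonneg_of_mem_Icc ⟨by linarith, by linarith⟩)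
      · have h6 := hc2 h5
        exact mul_nonneg_of_nonpos_of_nonpos (hneg _ h5 (by linarith)).le
          (Real.cos_nonpos_of_pi_div_two_le_of_le (by linarith) (by linarith))
  · rintro (⟨h2, h3⟩ | ⟨h2, h3⟩)
    · exact mul_neg_of_pos_of_neg (Real.cos_pos_of_mem_Ioo ⟨by linarith, by linarith⟩)
        (hneg' _ (by linarith) (by linarith))
    · exact mul_neg_of_neg_of_pos (hneg _ (by linarith) (by linarith))
        (Real.cos_pos_of_mem_Ioo ⟨by linarith, by linarith⟩)

theorem gaussianReal_prod_mul_neg {v : ℝ≥0} (hv : v ≠ 0) {θ : ℝ} (h0 : 0 < θ)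
    (h1 : θ < Real.pi / 2) :
    ((gaussianReal 0 v).prod (gaussianReal 0 v))
      {p | p.1 * (Real.cos θ * p.1 + Real.sin θ * p.2) < 0} = ENNReal.ofReal (θ / Real.pi) := by
  have hpi := Real.pi_pos
  rw [gaussianReal_prod_cone hv (E := Set.Ioo (-(Real.pi / 2)) (-(Real.pi / 2) + θ) ∪
        Set.Ioo (Real.pi / 2) (Real.pi / 2 + θ))
      (measurableSet_lt (by fun_prop) (by fun_prop))
      (measurableSet_Ioo.union measurableSet_Ioo)]
  · rw [Set.inter_eq_left.2, measure_union, Real.volume_Ioo, Real.volume_Ioo,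
      ← ENNReal.ofReal_add (by linarith) (by linarith), ← ENNReal.ofReal_div_of_pos (by linarith)]
    · congr 1
      field_simp
      ring
    · refine Set.disjoint_left.2 fun x hx hx' => ?_
      have := hx.2
      have := hx'.1
      linarith
    · exact measurableSet_Ioo
    · rintro x (⟨hx, hx'⟩ | ⟨hx, hx'⟩) <;> constructor <;> linarith
  · intro r hr α hα
    rw [← cos_mul_cos_sub_neg_iff h0 h1 hα, Set.mem_ofPred_eq, Real.cos_sub]
    have : r * Real.cos α * (Real.cos θ * (r * Real.cos α) + Real.sin θ * (r * Real.sin α))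
      = r ^ 2 * (Real.cos α * (Real.cos α * Real.cos θ + Real.sin α * Real.sin θ)) := by ring
    simp only [this]
    have hr2 : 0 < r ^ 2 := by positivity
    exact ⟨fun h => by by_contra h'; exact absurd h (not_lt.2 (mul_nonneg hr2.le (not_lt.1 h'))),
      fun h => mul_neg_of_pos_of_neg hr2 h⟩

/-- Sheppard's formula: two centred Gaussian variables of equal variance and correlation `cos θ`
have opposite signs with probability `θ / π`. -/
theorem piGaussian_mul_neg {ι : Type*} [Fintype ι] {v : ℝ≥0} (hv : v ≠ 0) {L θ : ℝ} (hL : 0 < L)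
    {c d : ι → ℝ} (hc : c ⬝ᵥ c = L) (hd : d ⬝ᵥ d = L) (hcd : c ⬝ᵥ d = L * Real.cos θ)
    (h0 : 0 < θ) (h1 : θ < Real.pi / 2) :
    piGaussian ι v {w | (c ⬝ᵥ w) * (d ⬝ᵥ w) < 0} = ENNReal.ofReal (θ / Real.pi) := by
  have hs : 0 < Real.sin θ := Real.sin_pos_of_pos_of_lt_pi h0 (by linarith [Real.pi_pos])
  -- Gram-Schmidt, scaled to the norm of `c`: `d = cos θ c + sin θ e`, and the forms of `c` and `e`
  -- are independent with equal variance.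
  set e : ι → ℝ := (Real.sin θ)⁻¹ • (d - Real.cos θ • c) with he
  have hdc : d ⬝ᵥ c = L * Real.cos θ := by rw [dotProduct_comm, hcd]
  have hce : c ⬝ᵥ e = 0 := by
    simp only [he, dotProduct_smul, dotProduct_sub, hc, hcd, smul_eq_mul]
    ring
  have hee : e ⬝ᵥ e = L := by
    simp only [he, dotProduct_smul, smul_dotProduct, sub_dotProduct, dotProduct_sub, hc, hcd, hdc,
      hd, smul_eq_mul]
    have := Real.sin_sq_add_cos_sq θ
    field_simp
    linear_combination -this
  have hlaw := hasLaw_prod_dotProduct v hc hee hce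
  have hv' : v * L.toNNReal ≠ 0 := mul_ne_zero hv (by simpa using hL)
  have hd' : ∀ w, d ⬝ᵥ w = Real.cos θ * (c ⬝ᵥ w) + Real.sin θ * (e ⬝ᵥ w) := by
    intro w
    simp only [he, smul_dotProduct, sub_dotProduct, smul_eq_mul]
    field_simp
    ring
  rw [← gaussianReal_prod_mul_neg hv' h0 h1, ← hlaw.map_eq,
    Measure.map_apply_of_aemeasurable hlaw.aemeasurable
      (measurableSet_lt (by fun_prop) (by fun_prop))]
  congr 1
  ext w
  simp [hd']

end Sheppard

/-! ### Counting zeros by sign changes on dyadic grids. -/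

section SignChanges

theorem Finset.exists_pos_forall_le {α : Type*} (s : Finset α) {f : α → ℝ}
    (hf : ∀ x ∈ s, 0 < f x) : ∃ η > 0, ∀ x ∈ s, η ≤ f x := by
  rcases s.eq_empty_or_nonempty with rfl | hs
  · exact ⟨1, one_pos, by simp⟩
  · obtain ⟨x, hx, h⟩ := s.exists_min_image f hs
    exact ⟨f x, hf x hx, h⟩

/-- The number of sign changes of `f` along the dyadic grid of level `k` of `[0, A]`. -/
noncomputable def signChanges (f : ℝ → ℝ) (A : ℝ) (k : ℕ) : ℕ :=
  ((Finset.range (2 ^ k)).filter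
    (fun i : ℕ => f (A * i / 2 ^ k) * f (A * (i + 1 : ℕ) / 2 ^ k) < 0)).card

/-- If the ends of a cell have opposite signs, the nonzero value at the midpoint differs in sign
from one of them; choosing that half is injective on cells. -/
theorem signChanges_mono {f : ℝ → ℝ} {A : ℝ} (h0 : ∀ k i : ℕ, f (A * i / 2 ^ k) ≠ 0) :
    Monotone (signChanges f A) := by
  classical
  refine monotone_nat_of_le_succ fun k => ?_
  unfold signChanges
  have e : ∀ i : ℕ, A * ((2 * i : ℕ) : ℝ) / 2 ^ (k + 1) = A * i / 2 ^ k := fun i => by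
    push_cast; rw [pow_succ]; field_simp
  let g : ℕ → ℕ := fun i =>
    if f (A * (2 * i : ℕ) / 2 ^ (k + 1)) * f (A * (2 * i + 1 : ℕ) / 2 ^ (k + 1)) < 0
      then 2 * i else 2 * i + 1
  refine Finset.card_le_card_of_injOn g (fun i hi => ?_) (fun i _ j _ hij => ?_)
  · simp only [Finset.coe_filter, Finset.mem_range, Set.mem_ofPred_eq] at hi ⊢
    obtain ⟨hi, hs⟩ := hi
    by_cases h : f (A * (2 * i : ℕ) / 2 ^ (k + 1)) * f (A * (2 * i + 1 : ℕ) / 2 ^ (k + 1)) < 0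
    · have : g i = 2 * i := if_pos h
      rw [this]
      exact ⟨by rw [pow_succ]; omega, h⟩
    · have : g i = 2 * i + 1 := if_neg h
      rw [this]
      refine ⟨by rw [pow_succ]; omega, ?_⟩
      have hm := h0 (k + 1) (2 * i + 1)
      rw [← e i, ← e (i + 1)] at hs
      rw [show 2 * i + 1 + 1 = 2 * (i + 1) by ring]
      set a := f (A * (2 * i : ℕ) / 2 ^ (k + 1))
      set b := f (A * (2 * i + 1 : ℕ) / 2 ^ (k + 1))
      set c := f (A * (2 * (i + 1) : ℕ) / 2 ^ (k + 1))
      by_contra hbc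
      have h1 : 0 ≤ (a * b) * (b * c) := mul_nonneg (not_lt.1 h) (not_lt.1 hbc)
      have h2 : (a * c) * (b * b) < 0 := mul_neg_of_neg_of_pos hs (mul_self_pos.2 hm)
      nlinarith
  · simp only [g] at hij
    split_ifs at hij <;> omega

theorem exists_zero_of_mul_neg {f : ℝ → ℝ} (hf : Continuous f) {u v : ℝ} (huv : u < v)
    (h : f u * f v < 0) : ∃ x ∈ Set.Ioo u v, f x = 0 := by
  rcases mul_neg_iff.1 h with ⟨h1, h2⟩ | ⟨h1, h2⟩
  · exact intermediate_value_Ioo' huv.le hf.continuousOn ⟨h2, h1⟩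
  · exact intermediate_value_Ioo huv.le hf.continuousOn ⟨h1, h2⟩

theorem signChanges_le_numZeros {f : ℝ → ℝ} (hf : Continuous f) {A : ℝ} (hA : 0 < A) (k : ℕ) :
    (signChanges f A k : ℝ≥0∞) ≤ numZeros f (Set.Ioo 0 A) := by
  classical
  unfold signChanges numZeros
  set s := (Finset.range (2 ^ k)).filter
    (fun i : ℕ => f (A * i / 2 ^ k) * f (A * (i + 1 : ℕ) / 2 ^ k) < 0) with hs
  have hz : ∀ i ∈ s, ∃ x ∈ Set.Ioo (A * i / 2 ^ k) (A * (i + 1 : ℕ) / 2 ^ k), f x = 0 := by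
    intro i hi
    refine exists_zero_of_mul_neg hf ?_ (Finset.mem_filter.1 hi).2
    push_cast
    gcongr
    linarith
  choose! z hz hfz using hz
  have hlt : ∀ i ∈ s, ∀ j ∈ s, i < j → z i < z j := by
    intro i hi j hj hij
    refine (hz i hi).2.trans_le (le_trans ?_ (hz j hj).1.le)
    gcongr
    omega
  have hinj : Set.InjOn z (s : Set ℕ) := by
    intro i hi j hj hij
    rcases lt_trichotomy i j with h | h | h
    · exact absurd hij (hlt i hi j hj h).ne
    · exact h
    · exact absurd hij (hlt j hj i hi h).ne'
  have hle : (s : Set ℕ).encard ≤ {x ∈ Set.Ioo 0 A | f x = 0}.encard := by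
    refine Set.encard_le_encard_of_injOn (fun i hi => ⟨⟨?_, ?_⟩, hfz i hi⟩) hinj
    · exact lt_of_le_of_lt (by positivity) (hz i hi).1
    · refine (hz i hi).2.trans_le ?_
      have : i + 1 ≤ 2 ^ k := Finset.mem_range.1 (Finset.mem_filter.1 hi).1
      have : ((i + 1 : ℕ) : ℝ) ≤ 2 ^ k := by exact_mod_cast this
      rw [div_le_iff₀ (by positivity)]
      gcongr
  rw [Set.encard_coe_eq_coe_finsetCard] at hle
  have := ENat.toENNReal_le.2 hle
  simpa using this

/-- Near a simple zero the slope from `z` has the sign of `f'`, so `f` changes sign there. -/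
theorem exists_mul_neg_of_hasDerivAt {f : ℝ → ℝ} {f' z : ℝ} (hf : HasDerivAt f f' z)
    (hz : f z = 0) (hf' : f' ≠ 0) :
    ∃ δ > 0, ∀ u v, z - δ < u → u < z → z < v → v < z + δ → f u * f v < 0 := by
  have h := hasDerivAt_iff_tendsto_slope.1 hf
  have h2 : Filter.Tendsto (fun y => slope f z y * f') (nhdsWithin z {z}ᶜ) (nhds (f' * f')) :=
    h.mul_const f'
  have h3 := h2.eventually (lt_mem_nhds (mul_self_pos.2 hf'))
  obtain ⟨δ, hδ, hb⟩ := Metric.mem_nhdsWithin_iff.1 h3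
  refine ⟨δ, hδ, fun u v hu huz hzv hv => ?_⟩
  have key : ∀ y, y ≠ z → |y - z| < δ → 0 < slope f z y * f' := fun y hy hyd =>
    hb ⟨by rwa [Metric.mem_ball, Real.dist_eq], hy⟩
  have hu' := key u huz.ne (by rw [abs_lt]; constructor <;> linarith)
  have hv' := key v hzv.ne' (by rw [abs_lt]; constructor <;> linarith)
  rw [slope_def_field, hz, sub_zero] at hu' hv'
  have h4 := mul_pos hu' hv'
  have h5 : (u - z) * (v - z) < 0 := mul_neg_of_neg_of_pos (by linarith) (by linarith)
  have hu0 : u - z ≠ 0 := by linarith [huz] |> fun h : u - z < 0 => h.ne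
  have hv0 : v - z ≠ 0 := (by linarith : 0 < v - z).ne'
  have h6 : f u / (u - z) * f' * (f v / (v - z) * f') * ((u - z) * (v - z))
      = f u * f v * (f' * f') := by field_simp
  have h7 : f u * f v * (f' * f') < 0 := h6 ▸ mul_neg_of_pos_of_neg h4 h5
  exact (mul_neg_iff.1 h7).elim (fun h => absurd h.2 (not_lt.2 (mul_self_nonneg _))) (·.1)

/-- Take a mesh finer than the sign-change radii of the finitely many zeros and than their mutual
distances: each zero makes its own cell count, and no cell contains two. -/
theorem exists_card_le_signChanges {f : ℝ → ℝ} {A : ℝ} (hA : 0 < A)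
    (h0 : ∀ k i : ℕ, f (A * i / 2 ^ k) ≠ 0) (hd : ∀ z, f z = 0 → ∃ f' ≠ 0, HasDerivAt f f' z)
    (F : Finset ℝ) (hF : ∀ z ∈ F, z ∈ Set.Ioo 0 A ∧ f z = 0) :
    ∃ k, F.card ≤ signChanges f A k := by
  classical
  have h1 : ∀ z ∈ F, ∃ δ > 0, ∀ u v, z - δ < u → u < z → z < v → v < z + δ → f u * f v < 0 := by
    intro z hz
    obtain ⟨f', hf', hder⟩ := hd z (hF z hz).2
    exact exists_mul_neg_of_hasDerivAt hder (hF z hz).2 hf'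
  choose! δ hδ hsign using h1
  have h2 : ∃ η > 0, ∀ z ∈ F, η ≤ δ z := by
    exact F.exists_pos_forall_le hδ
  obtain ⟨η, hη, hηδ⟩ := h2
  obtain ⟨η', hη', hsep⟩ : ∃ η' > 0, ∀ p ∈ F.offDiag, η' ≤ |p.1 - p.2| := by
    exact F.offDiag.exists_pos_forall_le
      (f := fun p : ℝ × ℝ => |p.1 - p.2|)
      (fun p hp => abs_pos.2 (sub_ne_zero.2 (Finset.mem_offDiag.1 hp).2.2))
  obtain ⟨k, hk⟩ : ∃ k : ℕ, A / 2 ^ k < min η η' := by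
    obtain ⟨k, hk⟩ := exists_pow_lt_of_lt_one (div_pos (lt_min hη hη') hA)
      (by norm_num : (1 / 2 : ℝ) < 1)
    refine ⟨k, ?_⟩
    rw [one_div, inv_pow, lt_div_iff₀ hA] at hk
    rwa [div_eq_inv_mul]
  refine ⟨k, ?_⟩
  have hp : (0 : ℝ) < 2 ^ k := by positivity
  let g : ℝ → ℕ := fun z => ⌊z * 2 ^ k / A⌋₊
  have hg : ∀ z ∈ F, A * g z / 2 ^ k < z ∧ z < A * (g z + 1 : ℕ) / 2 ^ k := by
    intro z hz
    have hz0 := (hF z hz).1.1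
    have ha : (g z : ℝ) ≤ z * 2 ^ k / A := Nat.floor_le (by positivity)
    have hb : z * 2 ^ k / A < (g z : ℝ) + 1 := Nat.lt_floor_add_one _
    rw [le_div_iff₀ hA] at ha
    rw [div_lt_iff₀ hA] at hb
    constructor
    -- The inequality is strict because no zero is a grid point.
    · refine lt_of_le_of_ne ?_ fun h => h0 k (g z) (by rw [h]; exact (hF z hz).2)
      rw [div_le_iff₀ hp]; linarith
    · rw [lt_div_iff₀ hp]; push_cast; linarith
  have hmesh : ∀ i : ℕ, A * (i + 1 : ℕ) / 2 ^ k = A * i / 2 ^ k + A / 2 ^ k := fun i => by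
    push_cast; ring
  have hkη := hk.trans_le (min_le_left _ _)
  have hkη' := hk.trans_le (min_le_right _ _)
  refine Finset.card_le_card_of_injOn g (fun z hz => ?_) (fun z hz z' hz' hzz => ?_)
  · simp only [Finset.coe_filter, Finset.mem_range, Set.mem_ofPred_eq]
    obtain ⟨ha, hb⟩ := hg z hz
    have hm := hmesh (g z)
    have hδz := hηδ z hz
    refine ⟨?_, hsign z hz _ _ (by linarith) ha hb (by linarith)⟩
    have h3 := ha.trans (hF z hz).1.2
    rw [div_lt_iff₀ hp] at h3
    have h4 : (g z : ℝ) < 2 ^ k := lt_of_mul_lt_mul_left h3 hA.le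
    exact_mod_cast h4
  · by_contra hne
    obtain ⟨ha, hb⟩ := hg z hz
    obtain ⟨ha', hb'⟩ := hg z' hz'
    rw [← hzz] at ha' hb'
    have hm := hmesh (g z)
    have := hsep (z, z') (Finset.mem_offDiag.2 ⟨hz, hz', hne⟩)
    have h5 : |z - z'| < A / 2 ^ k := by rw [abs_lt]; constructor <;> linarith
    simp only at this
    linarith

theorem numZeros_eq_iSup_signChanges {f : ℝ → ℝ} (hf : Continuous f) {A : ℝ} (hA : 0 < A)
    (h0 : ∀ k i : ℕ, f (A * i / 2 ^ k) ≠ 0) (hd : ∀ z, f z = 0 → ∃ f' ≠ 0, HasDerivAt f f' z) :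
    numZeros f (Set.Ioo 0 A) = ⨆ k, (signChanges f A k : ℝ≥0∞) := by
  refine le_antisymm ?_ (iSup_le fun k => signChanges_le_numZeros hf hA k)
  have hfin : ∀ F : Finset ℝ, (F : Set ℝ) ⊆ {x ∈ Set.Ioo 0 A | f x = 0} →
      (F.card : ℝ≥0∞) ≤ ⨆ k, (signChanges f A k : ℝ≥0∞) := by
    intro F hF
    obtain ⟨k, hk⟩ := exists_card_le_signChanges hA h0 hd F fun z hz => hF hz
    exact le_iSup_of_le k (by exact_mod_cast hk)
  unfold numZeros
  by_cases h : {x ∈ Set.Ioo 0 A | f x = 0}.Finite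
  · have := hfin h.toFinset (by simp)
    rw [h.encard_eq_coe_toFinset_card]
    simpa using this
  · rw [Set.encard_eq_top h]
    simp only [ENat.toENNReal_top, top_le_iff]
    -- An infinite zero set has finite subsets of every size, so the supremum is infinite too.
    refine ENNReal.eq_top_of_forall_nnreal_le fun r => ?_
    obtain ⟨n, hn⟩ := exists_nat_ge r
    obtain ⟨F, hF, hc⟩ := Set.Infinite.exists_subset_card_eq h n
    refine le_trans ?_ (hfin F hF)
    rw [hc]
    exact_mod_cast hn

end SignChanges

/-! ### Random trigonometric sums and the absence of multiple zeros. -/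

section TrigSum

variable {κ : Type*} [Fintype κ]

/-- The vector of the functions `cos (ν j x)`, `sin (ν j x)`. -/
noncomputable def trigVec (ν : κ → ℝ) (x : ℝ) : κ ⊕ κ → ℝ :=
  Sum.elim (fun j => Real.cos (ν j * x)) (fun j => Real.sin (ν j * x))

/-- The derivative of `trigVec`. -/
noncomputable def trigVecDeriv (ν : κ → ℝ) (x : ℝ) : κ ⊕ κ → ℝ :=
  Sum.elim (fun j => -(ν j * Real.sin (ν j * x))) (fun j => ν j * Real.cos (ν j * x))

theorem trigVec_dotProduct (ν : κ → ℝ) (x : ℝ) (w : κ ⊕ κ → ℝ) :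
    trigVec ν x ⬝ᵥ w =
      ∑ j, (w (.inl j) * Real.cos (ν j * x) + w (.inr j) * Real.sin (ν j * x)) := by
  simp only [dotProduct, trigVec, Fintype.sum_sum_type, Sum.elim_inl, Sum.elim_inr,
    ← Finset.sum_add_distrib, mul_comm]

theorem trigVec_dotProduct_trigVec (ν : κ → ℝ) (x y : ℝ) :
    trigVec ν x ⬝ᵥ trigVec ν y = ∑ j, Real.cos (ν j * (x - y)) := by
  rw [trigVec_dotProduct]
  refine Finset.sum_congr rfl fun j _ => ?_
  simp only [trigVec, Sum.elim_inl, Sum.elim_inr]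
  rw [mul_sub, Real.cos_sub]
  ring

theorem trigVec_dotProduct_self (ν : κ → ℝ) (x : ℝ) :
    trigVec ν x ⬝ᵥ trigVec ν x = Fintype.card κ := by
  simp [trigVec_dotProduct_trigVec]

theorem hasDerivAt_trigVec_dotProduct (ν : κ → ℝ) (w : κ ⊕ κ → ℝ) (x : ℝ) :
    HasDerivAt (fun x => trigVec ν x ⬝ᵥ w) (trigVecDeriv ν x ⬝ᵥ w) x := by
  simp only [dotProduct]
  refine HasDerivAt.fun_sum fun i _ => HasDerivAt.mul_const ?_ _
  have hx : ∀ j, HasDerivAt (fun x => ν j * x) (ν j) x := fun j => by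
    simpa using (hasDerivAt_id x).const_mul (ν j)
  rcases i with j | j
  · simp only [trigVec, trigVecDeriv, Sum.elim_inl]
    convert! (hx j).cos using 1
    ring
  · simp only [trigVec, trigVecDeriv, Sum.elim_inr]
    convert! (hx j).sin using 1
    ring

theorem continuous_trigVec_dotProduct (ν : κ → ℝ) (w : κ ⊕ κ → ℝ) :
    Continuous (fun x => trigVec ν x ⬝ᵥ w) :=
  continuous_iff_continuousAt.2 fun x => (hasDerivAt_trigVec_dotProduct ν w x).continuousAt

/-- The image of a differentiable self-map that ignores one coordinate is a null set. -/
theorem volume_range_eq_zero_of_update {ι : Type*} [Fintype ι] [DecidableEq ι]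
    {Ψ : (ι → ℝ) → ι → ℝ} (hΨ : Differentiable ℝ Ψ) (i : ι)
    (h : ∀ w t, Ψ (Function.update w i t) = Ψ w) : volume (Set.range Ψ) = 0 := by
  rw [← Set.image_univ]
  refine addHaar_image_eq_zero_of_det_fderivWithin_eq_zero volume
    (fun x _ => (hΨ x).hasFDerivAt.hasFDerivWithinAt) fun x _ => ?_
  -- The ignored direction lies in the kernel of the derivative, so its determinant vanishes.
  have hker : fderiv ℝ Ψ x (Pi.single i 1) = 0 := by
    have hline : HasDerivAt (fun t : ℝ => Function.update x i t) (Pi.single i (1 : ℝ)) (x i) :=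
      hasDerivAt_update x i (x i)
    have hx : HasFDerivAt Ψ (fderiv ℝ Ψ x) (Function.update x i (x i)) := by
      rw [Function.update_eq_self]; exact (hΨ x).hasFDerivAt
    have h1 := hx.comp_hasDerivAt (x i) hline
    have h2 : Ψ ∘ (fun t : ℝ => Function.update x i t) = fun _ => Ψ x := funext fun t => h x t
    rw [h2] at h1
    exact h1.unique (hasDerivAt_const _ _)
  by_contra hdet
  have hinj := (LinearMap.equivOfDetNeZero (fderiv ℝ Ψ x).toLinearMap hdet).injective
  have h3 : (Pi.single i (1 : ℝ) : ι → ℝ) = 0 := hinj (by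
    rw [map_zero]; exact hker)
  have := congrFun h3 i
  simp at this

/-- Bulinskaya's lemma: almost surely, the random trigonometric sum has no multiple zero. -/
theorem ae_forall_trigVecDeriv_ne_zero {v : ℝ≥0} (hv : v ≠ 0) (ν : κ → ℝ) (hν : ∃ j, ν j ≠ 0) :
    ∀ᵐ w ∂piGaussian (κ ⊕ κ) v, ∀ x, trigVec ν x ⬝ᵥ w = 0 → trigVecDeriv ν x ⬝ᵥ w ≠ 0 := by
  classical
  obtain ⟨j₀, hj₀⟩ := hν
  refine piGaussian_absolutelyContinuous hv ?_
  -- A double zero at `x` gives two linear equations that determine the `j₀` coefficients from `x`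
  -- and the others, since `ν j₀ ≠ 0`. `Ψ` solves them, reading `x` from the slot `.inl j₀` and
  -- ignoring `.inr j₀`; every bad `w` is thus in its range.
  let H : (κ ⊕ κ → ℝ) → ℝ := fun w => ∑ j ∈ Finset.univ.erase j₀,
    (w (.inl j) * Real.cos (ν j * w (.inl j₀)) + w (.inr j) * Real.sin (ν j * w (.inl j₀)))
  let H' : (κ ⊕ κ → ℝ) → ℝ := fun w => ∑ j ∈ Finset.univ.erase j₀,
    (w (.inl j) * -(ν j * Real.sin (ν j * w (.inl j₀)))
      + w (.inr j) * (ν j * Real.cos (ν j * w (.inl j₀))))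
  let Ψ : (κ ⊕ κ → ℝ) → κ ⊕ κ → ℝ := fun w i =>
    if i = .inl j₀ then
      -H w * Real.cos (ν j₀ * w (.inl j₀)) + H' w / ν j₀ * Real.sin (ν j₀ * w (.inl j₀))
    else if i = .inr j₀ then
      -H w * Real.sin (ν j₀ * w (.inl j₀)) - H' w / ν j₀ * Real.cos (ν j₀ * w (.inl j₀))
    else w i
  have hH : Differentiable ℝ H := by simp only [H]; fun_prop
  have hH' : Differentiable ℝ H' := by simp only [H']; fun_prop
  have hΨ : Differentiable ℝ Ψ := by
    refine differentiable_pi.2 fun i => ?_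
    simp only [Ψ]
    split_ifs <;> fun_prop
  have hupd : ∀ w t, Ψ (Function.update w (.inr j₀) t) = Ψ w := by
    intro w t
    have e1 : ∀ j, Function.update w (.inr j₀) t (.inl j) = w (.inl j) := fun j => by simp
    have e2 : ∀ j ∈ Finset.univ.erase j₀,
        Function.update w (.inr j₀) t (.inr j) = w (.inr j) := fun j hj => by
      simp [Finset.ne_of_mem_erase hj]
    have h1 : H (Function.update w (.inr j₀) t) = H w :=
      Finset.sum_congr rfl fun j hj => by rw [e1, e1, e2 j hj]
    have h2 : H' (Function.update w (.inr j₀) t) = H' w :=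
      Finset.sum_congr rfl fun j hj => by rw [e1, e1, e2 j hj]
    funext i
    simp only [Ψ, h1, h2, e1]
    split_ifs with h3 h4
    · rfl
    · rfl
    · simp [h4]
  refine measure_mono_null ?_ (volume_range_eq_zero_of_update hΨ _ hupd)
  intro w hw
  simp only [Set.mem_compl_iff, Set.mem_ofPred_eq, not_forall, not_not] at hw
  obtain ⟨x, hx, hx'⟩ := hw
  refine ⟨Function.update w (.inl j₀) x, ?_⟩
  set w' := Function.update w (.inl j₀) x with hw'
  have e0 : w' (.inl j₀) = x := by simp [hw']
  have e1 : ∀ j ∈ Finset.univ.erase j₀, w' (.inl j) = w (.inl j) := fun j hj => by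
    simp [hw', Finset.ne_of_mem_erase hj]
  have e2 : ∀ j, w' (.inr j) = w (.inr j) := fun j => by simp [hw']
  have h1 : H w' = -(w (.inl j₀) * Real.cos (ν j₀ * x) + w (.inr j₀) * Real.sin (ν j₀ * x)) := by
    rw [trigVec_dotProduct, ← Finset.add_sum_erase _ _ (Finset.mem_univ j₀)] at hx
    rw [eq_neg_iff_add_eq_zero, add_comm, ← hx]
    congr 1
    exact Finset.sum_congr rfl fun j hj => by rw [e1 j hj, e0, e2]
  have h2 : H' w' = -(w (.inl j₀) * -(ν j₀ * Real.sin (ν j₀ * x))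
      + w (.inr j₀) * (ν j₀ * Real.cos (ν j₀ * x))) := by
    simp only [dotProduct, trigVecDeriv, Fintype.sum_sum_type, Sum.elim_inl, Sum.elim_inr,
      ← Finset.sum_add_distrib] at hx'
    rw [← Finset.add_sum_erase _ _ (Finset.mem_univ j₀)] at hx'
    rw [eq_neg_iff_add_eq_zero, add_comm, ← hx']
    congr 1
    · ring
    · exact Finset.sum_congr rfl fun j hj => by rw [e1 j hj, e0, e2]; ring
  have hsc := Real.sin_sq_add_cos_sq (ν j₀ * x)
  funext i
  simp only [Ψ]
  split_ifs with h3 h4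
  · rw [h3, h1, h2, e0]
    field_simp
    linear_combination w (.inl j₀) * hsc
  · rw [h4, h1, h2, e0]
    field_simp
    linear_combination w (.inr j₀) * hsc
  · simp [hw', h3]

end TrigSum

/-! ### The expected number of zeros of a stationary sum. -/

section ExpectedZeros

variable {κ : Type*} [Fintype κ]

/-- The angle between `trigVec ν x` and `trigVec ν (x + h)`. -/
noncomputable def trigAngle (ν : κ → ℝ) (h : ℝ) : ℝ :=
  2 * Real.arcsin (Real.sqrt ((∑ j, Real.sin (ν j * h / 2) ^ 2) / Fintype.card κ))

theorem card_mul_cos_trigAngle [Nonempty κ] (ν : κ → ℝ) (h : ℝ) :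
    Fintype.card κ * Real.cos (trigAngle ν h) = ∑ j, Real.cos (ν j * h) := by
  have hn : (0 : ℝ) < Fintype.card κ := by exact_mod_cast Fintype.card_pos
  have h0 : 0 ≤ (∑ j, Real.sin (ν j * h / 2) ^ 2) / (Fintype.card κ : ℝ) :=
    div_nonneg (Finset.sum_nonneg fun _ _ => sq_nonneg _) hn.le
  have h1 : (∑ j, Real.sin (ν j * h / 2) ^ 2) / (Fintype.card κ : ℝ) ≤ 1 := by
    rw [div_le_one hn]
    calc _ ≤ ∑ j : κ, (1 : ℝ) := Finset.sum_le_sum fun j _ => Real.sin_sq_le_one _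
      _ = _ := by simp
  rw [trigAngle, Real.cos_two_mul, Real.cos_sq', Real.sin_arcsin
    (by linarith [Real.sqrt_nonneg ((∑ j, Real.sin (ν j * h / 2) ^ 2) / (Fintype.card κ : ℝ))])
    (Real.sqrt_le_one.2 h1), Real.sq_sqrt h0]
  have h2 : ∀ j, Real.cos (ν j * h) = 1 - 2 * Real.sin (ν j * h / 2) ^ 2 := fun j => by
    have h3 := Real.cos_two_mul (ν j * h / 2)
    rw [Real.cos_sq', mul_div_cancel₀ _ (two_ne_zero' ℝ)] at h3
    rw [h3]; ring
  simp_rw [h2]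
  rw [Finset.sum_sub_distrib, ← Finset.mul_sum]
  simp only [Finset.sum_const, Finset.card_univ, nsmul_eq_mul, mul_one]
  generalize ∑ j, Real.sin (ν j * h / 2) ^ 2 = S
  field_simp
  ring

/-- The half-angle form pays off here: `arcsin` is differentiable at `0`, while `arccos` is not at
`1`. -/
theorem tendsto_trigAngle_div (ν : κ → ℝ) :
    Filter.Tendsto (fun h => trigAngle ν h / h) (nhdsWithin 0 (Set.Ioi 0))
      (nhds (Real.sqrt ((∑ j, ν j ^ 2) / Fintype.card κ))) := by
  set s : ℝ → ℝ := fun h =>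
    Real.sqrt ((∑ j, Real.sin (ν j * h / 2) ^ 2) / Fintype.card κ) with hs
  have hsin : ∀ j, Filter.Tendsto (fun h => Real.sin (ν j * h / 2) / h)
      (nhdsWithin 0 (Set.Ioi 0)) (nhds (ν j / 2)) := fun j => by
    have hx : HasDerivAt (fun h => ν j * h / 2) (ν j / 2) 0 := by
      simpa using ((hasDerivAt_id (0 : ℝ)).const_mul (ν j)).div_const 2
    have h1 := hasDerivAt_iff_tendsto_slope.1 hx.sin
    have h2 := h1.mono_left (nhdsWithin_mono (s := Set.Ioi 0) 0 (fun y hy => (Set.mem_Ioi.1 hy).ne'))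
    simpa [slope_fun_def_field] using h2
  have hsdiv : Filter.Tendsto (fun h => s h / h) (nhdsWithin 0 (Set.Ioi 0))
      (nhds (Real.sqrt ((∑ j, (ν j / 2) ^ 2) / Fintype.card κ))) := by
    have h1 : Filter.Tendsto
        (fun h => Real.sqrt ((∑ j, (Real.sin (ν j * h / 2) / h) ^ 2) / Fintype.card κ))
        (nhdsWithin 0 (Set.Ioi 0)) (nhds (Real.sqrt ((∑ j, (ν j / 2) ^ 2) / Fintype.card κ))) :=
      ((tendsto_finsetSum _ fun j _ => (hsin j).pow 2).div_const _).sqrt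
    refine h1.congr' ?_
    filter_upwards [self_mem_nhdsWithin] with h hh
    have hh : 0 < h := hh
    simp only [hs, div_pow]
    rw [← Finset.sum_div, div_right_comm, Real.sqrt_div' _ (sq_nonneg h), Real.sqrt_sq hh.le]
  have hs0 : Filter.Tendsto s (nhdsWithin 0 (Set.Ioi 0)) (nhds 0) := by
    have hc : Continuous s := by simp only [hs]; fun_prop
    have := (hc.tendsto 0).mono_left (nhdsWithin_le_nhds (s := Set.Ioi (0 : ℝ)))
    simpa [hs] using this
  have hd : HasDerivAt Real.arcsin 1 0 := by
    simpa using Real.hasDerivAt_arcsin (x := 0) (by norm_num) (by norm_num)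
  -- `dslope` carries the derivative as its value at `0`, so `s h` need not be nonzero.
  have hds : Filter.Tendsto (fun h => dslope Real.arcsin 0 (s h)) (nhdsWithin 0 (Set.Ioi 0))
      (nhds 1) := by
    have h1 := (continuousAt_dslope_same.2 hd.differentiableAt).tendsto
    rw [dslope_same, hd.deriv] at h1
    exact h1.comp hs0
  have h2 := (hds.mul hsdiv).const_mul 2
  have h3 : 2 * (1 * Real.sqrt ((∑ j, (ν j / 2) ^ 2) / (Fintype.card κ : ℝ)))
      = Real.sqrt ((∑ j, ν j ^ 2) / Fintype.card κ) := by
    simp only [div_pow]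
    rw [← Finset.sum_div, div_right_comm, Real.sqrt_div' _ (by norm_num),
      Real.sqrt_sq (by norm_num)]
    ring
  rw [h3] at h2
  refine h2.congr fun h => ?_
  have h4 := sub_smul_dslope Real.arcsin 0 (s h)
  rw [Real.arcsin_zero, sub_zero, sub_zero, smul_eq_mul] at h4
  rw [trigAngle, ← h4]
  ring

theorem coe_signChanges (f : ℝ → ℝ) (A : ℝ) (k : ℕ) :
    (signChanges f A k : ℝ≥0∞) = ∑ i ∈ Finset.range (2 ^ k),
      if f (A * i / 2 ^ k) * f (A * (i + 1 : ℕ) / 2 ^ k) < 0 then 1 else 0 := by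
  rw [signChanges, Finset.sum_boole]

theorem measurableSet_trigVec_mul_neg (ν : κ → ℝ) (x y : ℝ) :
    MeasurableSet {w | (trigVec ν x ⬝ᵥ w) * (trigVec ν y ⬝ᵥ w) < 0} :=
  measurableSet_lt (Continuous.measurable (by fun_prop)) measurable_const

theorem measurable_signChanges (ν : κ → ℝ) (A : ℝ) (k : ℕ) :
    Measurable fun w : κ ⊕ κ → ℝ =>
      (signChanges (fun x => trigVec ν x ⬝ᵥ w) A k : ℝ≥0∞) := by
  simp_rw [coe_signChanges]
  exact Finset.measurable_fun_sum _ fun i _ =>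
    Measurable.ite (measurableSet_trigVec_mul_neg ν _ _) measurable_const measurable_const

/-- By stationarity all `2 ^ k` cells have the same angle, hence the same sign-change probability.
-/
theorem lintegral_signChanges [Nonempty κ] {v : ℝ≥0} (hv : v ≠ 0) (ν : κ → ℝ) (A : ℝ) (k : ℕ)
    (h0 : 0 < trigAngle ν (A / 2 ^ k)) (h1 : trigAngle ν (A / 2 ^ k) < Real.pi / 2) :
    ∫⁻ w, (signChanges (fun x => trigVec ν x ⬝ᵥ w) A k : ℝ≥0∞) ∂piGaussian (κ ⊕ κ) v
      = ENNReal.ofReal (2 ^ k * (trigAngle ν (A / 2 ^ k) / Real.pi)) := by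
  simp_rw [coe_signChanges]
  have hn : (0 : ℝ) < Fintype.card κ := by exact_mod_cast Fintype.card_pos
  rw [lintegral_finsetSum _ fun i _ =>
    Measurable.ite (measurableSet_trigVec_mul_neg ν _ _) measurable_const measurable_const]
  have h2 : ∀ i : ℕ, ∫⁻ w : κ ⊕ κ → ℝ, (if (trigVec ν (A * i / 2 ^ k) ⬝ᵥ w) *
      (trigVec ν (A * (i + 1 : ℕ) / 2 ^ k) ⬝ᵥ w) < 0 then (1 : ℝ≥0∞) else 0)
      ∂piGaussian (κ ⊕ κ) v = ENNReal.ofReal (trigAngle ν (A / 2 ^ k) / Real.pi) := by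
    intro i
    rw [← piGaussian_mul_neg hv hn (trigVec_dotProduct_self ν (A * i / 2 ^ k))
      (trigVec_dotProduct_self ν (A * (i + 1 : ℕ) / 2 ^ k)) ?_ h0 h1,
      ← lintegral_indicator_one (measurableSet_trigVec_mul_neg ν _ _)]
    · rfl
    · rw [trigVec_dotProduct_trigVec, card_mul_cos_trigAngle]
      refine Finset.sum_congr rfl fun j _ => ?_
      rw [← Real.cos_neg]
      congr 1
      push_cast
      ring
  rw [Finset.sum_congr rfl fun i _ => h2 i, Finset.sum_const, Finset.card_range, nsmul_eq_mul,
    ENNReal.ofReal_mul (by positivity)]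
  congr 1
  rw [ENNReal.ofReal_pow (by norm_num)]
  simp

theorem tendsto_lintegral_signChanges [Nonempty κ] {v : ℝ≥0} (hv : v ≠ 0) (ν : κ → ℝ)
    (hν : ∃ j, ν j ≠ 0) {A : ℝ} (hA : 0 < A) :
    Filter.Tendsto (fun k => ∫⁻ w, (signChanges (fun x => trigVec ν x ⬝ᵥ w) A k : ℝ≥0∞)
      ∂piGaussian (κ ⊕ κ) v) Filter.atTop
      (nhds (ENNReal.ofReal (A / Real.pi * Real.sqrt ((∑ j, ν j ^ 2) / Fintype.card κ)))) := by
  have hn : (0 : ℝ) < Fintype.card κ := by exact_mod_cast Fintype.card_pos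
  have hpos : 0 < Real.sqrt ((∑ j, ν j ^ 2) / (Fintype.card κ : ℝ)) := by
    obtain ⟨j, hj⟩ := hν
    refine Real.sqrt_pos.2 (div_pos (lt_of_lt_of_le (pow_pos (abs_pos.2 hj) 2) ?_) hn)
    rw [sq_abs]
    exact Finset.single_le_sum (f := fun j => ν j ^ 2) (fun _ _ => sq_nonneg _)
      (Finset.mem_univ j)
  have hstep : Filter.Tendsto (fun k : ℕ => A / 2 ^ k) Filter.atTop
      (nhdsWithin 0 (Set.Ioi 0)) := by
    refine tendsto_nhdsWithin_iff.2 ⟨?_, Filter.Eventually.of_forall fun k =>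
      show 0 < A / 2 ^ k by positivity⟩
    exact tendsto_const_nhds.div_atTop (tendsto_pow_atTop_atTop_of_one_lt (by norm_num))
  have hlim := (tendsto_trigAngle_div ν).comp hstep
  have hlim0 : Filter.Tendsto (fun k : ℕ => trigAngle ν (A / 2 ^ k)) Filter.atTop (nhds 0) := by
    have h1 := hlim.mul (tendsto_nhdsWithin_iff.1 hstep).1
    rw [mul_zero] at h1
    refine h1.congr fun k => ?_
    have : A / 2 ^ k ≠ 0 := by positivity
    simp only [Function.comp_apply]
    field_simp
  -- With `h = A / 2 ^ k`, `2 ^ k θ(h) / π = (A / π) (θ(h) / h)`; Sheppard's formula applies once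
  -- `θ(h) < π / 2`.
  refine (ENNReal.tendsto_ofReal (hlim.const_mul (A / Real.pi))).congr' ?_
  filter_upwards [hlim.eventually (lt_mem_nhds hpos),
    hlim0.eventually (gt_mem_nhds (by positivity : 0 < Real.pi / 2))] with k h1 h2
  have hk : 0 < A / 2 ^ k := by positivity
  have h3 : 0 < trigAngle ν (A / 2 ^ k) := (div_pos_iff_of_pos_right hk).1 h1
  rw [lintegral_signChanges hv ν A k h3 h2]
  congr 1
  simp only [Function.comp_apply]
  field_simp

theorem ae_numZeros_eq_iSup [Nonempty κ] {v : ℝ≥0} (hv : v ≠ 0) (ν : κ → ℝ) (hν : ∃ j, ν j ≠ 0)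
    {A : ℝ} (hA : 0 < A) :
    ∀ᵐ w ∂piGaussian (κ ⊕ κ) v,
      Monotone (signChanges (fun x => trigVec ν x ⬝ᵥ w) A) ∧
      numZeros (fun x => trigVec ν x ⬝ᵥ w) (Set.Ioo 0 A)
        = ⨆ k, (signChanges (fun x => trigVec ν x ⬝ᵥ w) A k : ℝ≥0∞) := by
  have hn : (0 : ℝ) < Fintype.card κ := by exact_mod_cast Fintype.card_pos
  have h0 : ∀ᵐ w ∂piGaussian (κ ⊕ κ) v, ∀ k i : ℕ, trigVec ν (A * i / 2 ^ k) ⬝ᵥ w ≠ 0 :=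
    ae_all_iff.2 fun k => ae_all_iff.2 fun i =>
      ae_dotProduct_ne_zero hv (by rw [trigVec_dotProduct_self]; exact hn)
  filter_upwards [h0, ae_forall_trigVecDeriv_ne_zero hv ν hν] with w hw hw'
  exact ⟨signChanges_mono hw, numZeros_eq_iSup_signChanges (continuous_trigVec_dotProduct ν w) hA
    hw fun z hz => ⟨_, hw' z hz, hasDerivAt_trigVec_dotProduct ν w z⟩⟩

theorem aemeasurable_numZeros_trigVec [Nonempty κ] {v : ℝ≥0} (hv : v ≠ 0) (ν : κ → ℝ)
    (hν : ∃ j, ν j ≠ 0) {A : ℝ} (hA : 0 < A) :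
    AEMeasurable (fun w => numZeros (fun x => trigVec ν x ⬝ᵥ w) (Set.Ioo 0 A))
      (piGaussian (κ ⊕ κ) v) :=
  ⟨_, Measurable.iSup fun k => measurable_signChanges ν A k,
    (ae_numZeros_eq_iSup hv ν hν hA).mono fun _ h => h.2⟩

/-- The expected number of zeros of a stationary Gaussian trigonometric sum. -/
theorem lintegral_numZeros_trigVec [Nonempty κ] {v : ℝ≥0} (hv : v ≠ 0) (ν : κ → ℝ)
    (hν : ∃ j, ν j ≠ 0) {A : ℝ} (hA : 0 < A) :
    ∫⁻ w, numZeros (fun x => trigVec ν x ⬝ᵥ w) (Set.Ioo 0 A) ∂piGaussian (κ ⊕ κ) v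
      = ENNReal.ofReal (A / Real.pi * Real.sqrt ((∑ j, ν j ^ 2) / Fintype.card κ)) := by
  have hae := ae_numZeros_eq_iSup hv ν hν hA
  refine tendsto_nhds_unique (lintegral_tendsto_of_tendsto_of_monotone
    (fun k => (measurable_signChanges ν A k).aemeasurable) ?_ ?_)
    (tendsto_lintegral_signChanges hv ν hν hA)
  · filter_upwards [hae] with w hw k l hkl
    exact Nat.cast_le.2 (hw.1 hkl)
  · filter_upwards [hae] with w hw
    rw [hw.2]
    exact tendsto_atTop_iSup fun k l hkl => Nat.cast_le.2 (hw.1 hkl)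

end ExpectedZeros

/-! ### Factoring out the Dirichlet kernel, and its zeros. -/

section PeriodicCoefficients

theorem IsPeriodicCoeffs.eq_mod {ℓ n : ℕ} {a : ℕ → ℝ} (h : IsPeriodicCoeffs ℓ n a) (hℓ : 1 ≤ ℓ)
    (j : ℕ) (hj : j ≤ n) : a j = a (j % ℓ) := by
  induction j using Nat.strong_induction_on with
  | _ j ih =>
    rcases lt_or_ge j ℓ with hlt | hge
    · rw [Nat.mod_eq_of_lt hlt]
    · have h1 := h (j - ℓ) (by omega)
      rw [Nat.sub_add_cancel hge] at h1
      rw [h1, ih (j - ℓ) (by omega) (by omega), Nat.mod_eq_sub_mod hge]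

theorem Finset.sum_range_mul_eq_sum_sum (f : ℕ → ℝ) (ℓ m : ℕ) :
    ∑ i ∈ Finset.range (ℓ * m), f i
      = ∑ k ∈ Finset.range m, ∑ j ∈ Finset.range ℓ, f (ℓ * k + j) := by
  induction m with
  | zero => simp
  | succ m ih => rw [Nat.mul_succ, Finset.sum_range_add, ih, Finset.sum_range_succ]

/-- Multiplying by `2 sin(y/2)` makes the sum telescope. -/
theorem sin_half_mul_sum_cos (t y : ℝ) (m : ℕ) :
    Real.sin (y / 2) * ∑ k ∈ Finset.range m, Real.cos (t + k * y)
      = Real.sin (m * y / 2) * Real.cos (t + (m - 1) * y / 2) := by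
  have h1 : ∀ k : ℕ, 2 * (Real.sin (y / 2) * Real.cos (t + k * y))
      = Real.sin (t + ((k + 1 : ℕ) : ℝ) * y - y / 2) - Real.sin (t + k * y - y / 2) := fun k => by
    rw [Real.sin_sub_sin, mul_assoc]
    push_cast
    congr 3 <;> ring
  have h2 : 2 * (Real.sin (m * y / 2) * Real.cos (t + (m - 1) * y / 2))
      = Real.sin (t + m * y - y / 2) - Real.sin (t + ((0 : ℕ) : ℝ) * y - y / 2) := by
    rw [Real.sin_sub_sin, mul_assoc]
    push_cast
    congr 3 <;> ring
  have h3 := Finset.sum_range_sub (fun k : ℕ => Real.sin (t + k * y - y / 2)) m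
  rw [← h2, ← Finset.sum_congr rfl fun k _ => h1 k, ← Finset.mul_sum, ← Finset.mul_sum] at h3
  linarith

theorem sin_half_mul_sum_sin (t y : ℝ) (m : ℕ) :
    Real.sin (y / 2) * ∑ k ∈ Finset.range m, Real.sin (t + k * y)
      = Real.sin (m * y / 2) * Real.sin (t + (m - 1) * y / 2) := by
  have h := sin_half_mul_sum_cos (t - Real.pi / 2) y m
  have e : ∀ z, Real.cos (t - Real.pi / 2 + z) = Real.sin (t + z) := fun z => by
    rw [show t - Real.pi / 2 + z = t + z - Real.pi / 2 by ring, Real.cos_sub_pi_div_two]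
  simpa only [e] using h

/-- The frequencies `j + (m - 1) ℓ / 2`, `j < ℓ`. -/
noncomputable def shiftedFreq (ℓ m : ℕ) (j : Fin ℓ) : ℝ := j + (m - 1) * ℓ / 2

/-- A trigonometric polynomial with `ℓ`-periodic coefficients is a Dirichlet kernel times a
trigonometric sum with `ℓ` frequencies. -/
theorem sin_mul_trigPoly {ℓ m n : ℕ} (hn : n + 1 = ℓ * m) {a b : ℕ → ℝ} {w : Fin ℓ ⊕ Fin ℓ → ℝ}
    (ha : ∀ k (j : Fin ℓ), ℓ * k + j ≤ n → a (ℓ * k + j) = w (.inl j))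
    (hb : ∀ k (j : Fin ℓ), ℓ * k + j ≤ n → b (ℓ * k + j) = w (.inr j)) (x : ℝ) :
    Real.sin (ℓ * x / 2) * trigPoly n a b x
      = Real.sin (m * (ℓ * x) / 2) * (trigVec (shiftedFreq ℓ m) x ⬝ᵥ w) := by
  rw [trigPoly, hn, Finset.sum_range_mul_eq_sum_sum, trigVec_dotProduct, Finset.sum_comm,
    Finset.sum_range, Finset.mul_sum, Finset.mul_sum]
  refine Finset.sum_congr rfl fun j _ => ?_
  have h1 : ∀ k ∈ Finset.range m,
      a (ℓ * k + j) * Real.cos ((ℓ * k + j : ℕ) * x) + b (ℓ * k + j) * Real.sin ((ℓ * k + j : ℕ) * x)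
      = w (.inl j) * Real.cos (j * x + k * (ℓ * x)) + w (.inr j) * Real.sin (j * x + k * (ℓ * x)) := by
    intro k hk
    have hle : ℓ * k + j ≤ n := by
      have h2 : ℓ * (k + 1) ≤ ℓ * m := Nat.mul_le_mul_left _ (Finset.mem_range.1 hk)
      have := j.2
      rw [Nat.mul_succ] at h2
      omega
    rw [ha k j hle, hb k j hle]
    push_cast
    congr 3 <;> ring
  rw [Finset.sum_congr rfl h1, Finset.sum_add_distrib, ← Finset.mul_sum, ← Finset.mul_sum,
    mul_add, mul_left_comm, sin_half_mul_sum_cos, mul_left_comm _ (w (.inr j)),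
    sin_half_mul_sum_sin]
  have e : (j : ℝ) * x + (m - 1) * (ℓ * x) / 2 = shiftedFreq ℓ m j * x := by
    rw [shiftedFreq]; ring
  rw [e]
  ring

/-- The zeros of the Dirichlet kernel in `(0, 2π)`. -/
def kernelZeros (ℓ m : ℕ) : Set ℝ :=
  {x ∈ Set.Ioo 0 (2 * Real.pi) | Real.sin (m * (ℓ * x) / 2) = 0 ∧ Real.sin (ℓ * x / 2) ≠ 0}

theorem exists_nat_of_sin_eq_zero {ℓ m : ℕ} (hℓ : 0 < ℓ) (hm : 0 < m) {x : ℝ}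
    (hx : x ∈ Set.Ioo 0 (2 * Real.pi)) (h : Real.sin (m * (ℓ * x) / 2) = 0) :
    ∃ k < ℓ * m, x = 2 * Real.pi * k / (ℓ * m) := by
  obtain ⟨q, hq⟩ := Real.sin_eq_zero_iff.1 h
  have hpi := Real.pi_pos
  have hℓ' : (0 : ℝ) < ℓ := by exact_mod_cast hℓ
  have hm' : (0 : ℝ) < m := by exact_mod_cast hm
  have hq0 : (0 : ℝ) < q := by
    have : 0 < (q : ℝ) * Real.pi := by rw [hq]; have := hx.1; positivity
    exact (pos_iff_pos_of_mul_pos this).2 hpi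
  have hxq : x = 2 * Real.pi * q / (ℓ * m) := by
    field_simp
    linarith
  lift q to ℕ using (by exact_mod_cast hq0.le)
  refine ⟨q, ?_, by exact_mod_cast hxq⟩
  have h2 := hx.2
  rw [hxq, div_lt_iff₀ (by positivity)] at h2
  have h3 : ((q : ℤ) : ℝ) < ℓ * m := lt_of_mul_lt_mul_left h2 (by positivity)
  exact_mod_cast h3

theorem sin_half_eq_zero_iff_dvd {ℓ m k : ℕ} (hℓ : 0 < ℓ) (hm : 0 < m) :
    Real.sin (ℓ * (2 * Real.pi * k / (ℓ * m)) / 2) = 0 ↔ m ∣ k := by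
  have hpi := Real.pi_pos
  have hℓ' : (0 : ℝ) < ℓ := by exact_mod_cast hℓ
  have hm' : (0 : ℝ) < m := by exact_mod_cast hm
  rw [Real.sin_eq_zero_iff]
  constructor
  · rintro ⟨q, hq⟩
    have h1 : (k : ℝ) = m * q := by
      field_simp at hq
      linarith
    have h2 : (k : ℤ) = m * q := by exact_mod_cast h1
    exact Int.natCast_dvd_natCast.1 ⟨q, h2⟩
  · rintro ⟨q, rfl⟩
    refine ⟨q, ?_⟩
    push_cast
    field_simp

/-- The zeros are `2πk/(ℓm)` with `k < ℓm` and `m ∤ k`; the `ℓ` multiples of `m` removed include `k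
= 0`, which keeps the points inside the open interval. -/
theorem encard_kernelZeros {ℓ m : ℕ} (hℓ : 0 < ℓ) (hm : 0 < m) :
    (kernelZeros ℓ m).encard = ((ℓ * m - ℓ : ℕ) : ℕ∞) := by
  classical
  have hpi := Real.pi_pos
  have hℓ' : (0 : ℝ) < ℓ := by exact_mod_cast hℓ
  have hm' : (0 : ℝ) < m := by exact_mod_cast hm
  have himg : kernelZeros ℓ m = (fun k : ℕ => 2 * Real.pi * k / (ℓ * m)) ''
      (((Finset.range (ℓ * m)).filter fun k => ¬ m ∣ k : Finset ℕ) : Set ℕ) := by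
    ext x
    constructor
    · rintro ⟨hx, h1, h2⟩
      obtain ⟨k, hk, rfl⟩ := exists_nat_of_sin_eq_zero hℓ hm hx h1
      rw [Ne, sin_half_eq_zero_iff_dvd hℓ hm] at h2
      exact ⟨k, by simp [hk, h2], rfl⟩
    · rintro ⟨k, hk, rfl⟩
      obtain ⟨hk, hmk⟩ := Finset.mem_filter.1 hk
      have hk := Finset.mem_range.1 hk
      have hk0 : 0 < k := Nat.pos_of_ne_zero fun h => hmk (h ▸ dvd_zero m)
      have hk0' : (0 : ℝ) < k := by exact_mod_cast hk0
      have hk' : (k : ℝ) < ℓ * m := by exact_mod_cast hk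
      refine ⟨⟨by positivity, ?_⟩, ?_, ?_⟩
      · rw [div_lt_iff₀ (by positivity)]
        gcongr
      · refine Real.sin_eq_zero_iff.2 ⟨k, ?_⟩
        push_cast
        field_simp
      · rwa [Ne, sin_half_eq_zero_iff_dvd hℓ hm]
  have hinj : Function.Injective (fun k : ℕ => 2 * Real.pi * k / (ℓ * m)) := by
    intro k k' h
    simp only at h
    field_simp at h
    exact_mod_cast h
  rw [himg, hinj.encard_image, Set.encard_coe_eq_coe_finsetCard]
  congr 1
  have h1 : (Finset.range (ℓ * m)).filter (fun k => m ∣ k)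
      = (Finset.range ℓ).image (fun q => q * m) := by
    ext k
    simp only [Finset.mem_filter, Finset.mem_range, Finset.mem_image]
    constructor
    · rintro ⟨hk, q, rfl⟩
      refine ⟨q, ?_, mul_comm _ _⟩
      rw [mul_comm] at hk
      exact lt_of_mul_lt_mul_right hk (Nat.zero_le _)
    · rintro ⟨q, hq, rfl⟩
      exact ⟨Nat.mul_lt_mul_of_pos_right hq hm, dvd_mul_left _ _⟩
  have h2 := Finset.card_filter_add_card_filter_not (s := Finset.range (ℓ * m)) (fun k => m ∣ k)
  rw [h1, Finset.card_image_of_injective _ (fun _ _ h => Nat.eq_of_mul_eq_mul_right hm h),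
    Finset.card_range, Finset.card_range] at h2
  omega

theorem differentiable_trigPoly (n : ℕ) (a b : ℕ → ℝ) : Differentiable ℝ (trigPoly n a b) := by
  unfold trigPoly
  fun_prop

theorem numZeros_trigPoly_eq {ℓ m n : ℕ} (hℓ : 0 < ℓ) (hm : 0 < m) (hn : n + 1 = ℓ * m)
    {a b : ℕ → ℝ} {w : Fin ℓ ⊕ Fin ℓ → ℝ}
    (ha : ∀ k (j : Fin ℓ), ℓ * k + j ≤ n → a (ℓ * k + j) = w (.inl j))
    (hb : ∀ k (j : Fin ℓ), ℓ * k + j ≤ n → b (ℓ * k + j) = w (.inr j))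
    (hw : ∀ k < ℓ * m, trigVec (shiftedFreq ℓ m) (2 * Real.pi * (k : ℕ) / (ℓ * m)) ⬝ᵥ w ≠ 0) :
    numZeros (trigPoly n a b) (Set.Ioo 0 (2 * Real.pi))
      = ((ℓ * m - ℓ : ℕ) : ℝ≥0∞) +
        numZeros (fun x => trigVec (shiftedFreq ℓ m) x ⬝ᵥ w) (Set.Ioo 0 (2 * Real.pi)) := by
  have hℓ' : (0 : ℝ) < ℓ := by exact_mod_cast hℓ
  have hm' : (0 : ℝ) < m := by exact_mod_cast hm
  have hG : ∀ x ∈ Set.Ioo 0 (2 * Real.pi), Real.sin (m * (ℓ * x) / 2) = 0 →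
      trigVec (shiftedFreq ℓ m) x ⬝ᵥ w ≠ 0 := by
    intro x hx h
    obtain ⟨k, hk, rfl⟩ := exists_nat_of_sin_eq_zero hℓ hm hx h
    exact hw k hk
  have hfac := sin_mul_trigPoly hn ha hb
  have hset : {x ∈ Set.Ioo 0 (2 * Real.pi) | trigPoly n a b x = 0} = kernelZeros ℓ m ∪
      {x ∈ Set.Ioo 0 (2 * Real.pi) | trigVec (shiftedFreq ℓ m) x ⬝ᵥ w = 0} := by
    ext x
    simp only [kernelZeros, Set.mem_union, Set.mem_ofPred_eq, ← and_or_left]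
    refine and_congr_right fun hx => ?_
    have hfx := hfac x
    -- When both sines vanish the factorisation says nothing at `x`; differentiating it shows that
    -- `T_n(x)` is a nonzero multiple of `G(x) ≠ 0`.
    by_cases hs : Real.sin (ℓ * x / 2) = 0
    · have hs2 : Real.sin (m * (ℓ * x) / 2) = 0 := by
        obtain ⟨q, hq⟩ := Real.sin_eq_zero_iff.1 hs
        refine Real.sin_eq_zero_iff.2 ⟨m * q, ?_⟩
        push_cast
        rw [mul_assoc, hq]
        ring
      have hg := hG x hx hs2
      have hc : Real.cos (m * (ℓ * x) / 2) ≠ 0 := fun hc => by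
        have := Real.sin_sq_add_cos_sq (m * (ℓ * x) / 2)
        rw [hs2, hc] at this
        norm_num at this
      have d1 : HasDerivAt (fun x : ℝ => Real.sin (ℓ * x / 2))
          (Real.cos (ℓ * x / 2) * (ℓ / 2)) x := by
        have : HasDerivAt (fun x : ℝ => ℓ * x / 2) ((ℓ : ℝ) / 2) x := by
          simpa using ((hasDerivAt_id x).const_mul (ℓ : ℝ)).div_const 2
        exact this.sin
      have d2 : HasDerivAt (fun x : ℝ => Real.sin (m * (ℓ * x) / 2))
          (Real.cos (m * (ℓ * x) / 2) * (m * ℓ / 2)) x := by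
        have : HasDerivAt (fun x : ℝ => m * (ℓ * x) / 2) ((m : ℝ) * ℓ / 2) x := by
          simpa using (((hasDerivAt_id x).const_mul (ℓ : ℝ)).const_mul (m : ℝ)).div_const 2
        exact this.sin
      have d3 := d1.mul (differentiable_trigPoly n a b x).hasDerivAt
      have d4 := d2.mul (hasDerivAt_trigVec_dotProduct (shiftedFreq ℓ m) w x)
      have d5 := d3.unique (d4.congr_of_eventuallyEq (Filter.Eventually.of_forall hfac))
      simp only [hs, hs2, zero_mul, add_zero] at d5
      have hT : trigPoly n a b x ≠ 0 := fun hT => by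
        rw [hT, mul_zero] at d5
        exact mul_ne_zero (mul_ne_zero hc (by positivity)) hg d5.symm
      simp [hs, hg, hT]
    · simp only [hs, not_false_eq_true, and_true, ne_eq]
      rw [← mul_eq_zero, ← hfx]
      simp [hs]
  have hdisj : Disjoint (kernelZeros ℓ m)
      {x ∈ Set.Ioo 0 (2 * Real.pi) | trigVec (shiftedFreq ℓ m) x ⬝ᵥ w = 0} :=
    Set.disjoint_left.2 fun x hx hx' => hG x hx.1 hx.2.1 hx'.2
  unfold numZeros
  rw [hset, Set.encard_union_eq hdisj, encard_kernelZeros hℓ hm, ENat.toENNReal_add]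
  simp

theorem sum_range_add_sq (ℓ : ℕ) (s : ℝ) :
    ∑ j ∈ Finset.range ℓ, ((j : ℝ) + s) ^ 2
      = ℓ * (ℓ - 1) * (2 * ℓ - 1) / 6 + s * (ℓ * (ℓ - 1)) + ℓ * s ^ 2 := by
  induction ℓ with
  | zero => simp
  | succ ℓ ih => rw [Finset.sum_range_succ, ih]; push_cast; ring

theorem two_mul_sqrt_mean_shiftedFreq {ℓ m n : ℕ} (hℓ : 0 < ℓ) (hn : n + 1 = ℓ * m) :
    2 * Real.pi / Real.pi *
        Real.sqrt ((∑ j, shiftedFreq ℓ m j ^ 2) / (Fintype.card (Fin ℓ) : ℝ))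
      = Real.sqrt ((n : ℝ) ^ 2 + ((ℓ : ℝ) ^ 2 - 1) / 3) := by
  have hℓ' : (ℓ : ℝ) ≠ 0 := by exact_mod_cast hℓ.ne'
  have hn' : (n : ℝ) = ℓ * m - 1 := by
    rw [eq_sub_iff_add_eq]; exact_mod_cast hn
  have hsum : ∑ j, shiftedFreq ℓ m j ^ 2
      = ∑ j ∈ Finset.range ℓ, ((j : ℝ) + (m - 1) * ℓ / 2) ^ 2 := by
    rw [Finset.sum_range]
    rfl
  rw [hsum, sum_range_add_sq, Fintype.card_fin, mul_div_cancel_right₀ _ Real.pi_ne_zero]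
  -- The factor `2` from the interval length enters the root as `4`.
  nth_rewrite 1 [← Real.sqrt_sq (zero_le_two (α := ℝ))]
  rw [← Real.sqrt_mul (by positivity), hn']
  congr 1
  field_simp
  ring

end PeriodicCoefficients

end

/-! ### Transfer to the given probability space. -/

theorem theorem2p1 {Ω : Type*} [MeasurableSpace Ω] (P : MeasureTheory.Measure Ω)
    [MeasureTheory.IsProbabilityMeasure P]
    (ℓ m n : ℕ) (hℓ : 1 ≤ ℓ) (hm : 2 ≤ m) (hn : n + 1 = ℓ * m)
    (σ : ℝ≥0) (hσ : 0 < σ)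
    (a b : ℕ → Ω → ℝ)
    (ha_law : ∀ i < ℓ, ProbabilityTheory.HasLaw (a i) (ProbabilityTheory.gaussianReal 0 (σ ^ 2)) P)
    (hb_law : ∀ i < ℓ, ProbabilityTheory.HasLaw (b i) (ProbabilityTheory.gaussianReal 0 (σ ^ 2)) P)
    (h_indep : ProbabilityTheory.iIndepFun
      (Sum.elim (fun i : Fin ℓ => a i) (fun i : Fin ℓ => b i)) P)
    (ha_per : ∀ᵐ ω ∂P, IsPeriodicCoeffs ℓ n (fun i => a i ω))
    (hb_per : ∀ᵐ ω ∂P, IsPeriodicCoeffs ℓ n (fun i => b i ω)) :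
    AEMeasurable
      (fun ω => numZeros (trigPoly n (fun i => a i ω) (fun i => b i ω))
        (Set.Ioo 0 (2 * Real.pi))) P ∧
    ∫⁻ ω, numZeros (trigPoly n (fun i => a i ω) (fun i => b i ω))
        (Set.Ioo 0 (2 * Real.pi)) ∂P
      = ENNReal.ofReal ((n : ℝ) + 1 - ℓ + Real.sqrt ((n : ℝ) ^ 2 + ((ℓ : ℝ) ^ 2 - 1) / 3)) := by
  classical
  have hℓ0 : 0 < ℓ := hℓ
  have hm0 : 0 < m := by omega
  have : Nonempty (Fin ℓ) := ⟨⟨0, hℓ0⟩⟩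
  have hv : σ ^ 2 ≠ 0 := pow_ne_zero 2 hσ.ne'
  have hpi := Real.pi_pos
  set μ := piGaussian (Fin ℓ ⊕ Fin ℓ) (σ ^ 2) with hμ
  set ν := shiftedFreq ℓ m with hν
  set W : Ω → Fin ℓ ⊕ Fin ℓ → ℝ := fun ω i =>
    Sum.elim (fun i : Fin ℓ => a i) (fun i : Fin ℓ => b i) i ω with hW
  have hlaw1 : ∀ i : Fin ℓ ⊕ Fin ℓ, ProbabilityTheory.HasLaw
      (Sum.elim (fun i : Fin ℓ => a i) (fun i : Fin ℓ => b i) i)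
      (ProbabilityTheory.gaussianReal 0 (σ ^ 2)) P := by
    rintro (i | i)
    · exact ha_law i i.2
    · exact hb_law i i.2
  have hlaw : ProbabilityTheory.HasLaw W μ P := by
    refine ⟨aemeasurable_pi_lambda _ fun i => (hlaw1 i).aemeasurable, ?_⟩
    rw [hW, (ProbabilityTheory.iIndepFun_iff_map_fun_eq_pi_map
      fun i => (hlaw1 i).aemeasurable).1 h_indep]
    simp only [(hlaw1 _).map_eq, hμ]
  -- The lowest frequency is `(m - 1)ℓ/2`, positive because `m ≥ 2`.
  have hνne : ∃ j, ν j ≠ 0 := by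
    refine ⟨⟨0, hℓ0⟩, ?_⟩
    have h1 : (0 : ℝ) < ℓ := by exact_mod_cast hℓ0
    have h2 : (1 : ℝ) < m := by exact_mod_cast hm
    have h3 : 0 < ((m : ℝ) - 1) * ℓ / 2 := by have := sub_pos.2 h2; positivity
    simpa [hν, shiftedFreq] using h3.ne'
  -- These points contain all zeros of both sines in `(0, 2π)`, so `G` almost surely shares no zero
  -- with the kernel.
  have hgrid : ∀ᵐ w ∂μ, ∀ k < ℓ * m, trigVec ν (2 * Real.pi * (k : ℕ) / (ℓ * m)) ⬝ᵥ w ≠ 0 :=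
    MeasureTheory.ae_all_iff.2 fun k => by
      have := ae_dotProduct_ne_zero hv (c := trigVec ν (2 * Real.pi * (k : ℕ) / (ℓ * m)))
        (by rw [trigVec_dotProduct_self, Fintype.card_fin]; exact_mod_cast hℓ0)
      filter_upwards [this] with w hw _ using hw
  have hgridΩ : ∀ᵐ ω ∂P, ∀ k < ℓ * m,
      trigVec ν (2 * Real.pi * (k : ℕ) / (ℓ * m)) ⬝ᵥ W ω ≠ 0 := by
    rw [← hlaw.map_eq] at hgrid
    exact MeasureTheory.ae_of_ae_map hlaw.aemeasurable hgrid
  set N : (Fin ℓ ⊕ Fin ℓ → ℝ) → ℝ≥0∞ := fun w =>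
    numZeros (fun x => trigVec ν x ⬝ᵥ w) (Set.Ioo 0 (2 * Real.pi)) with hN
  have hNm : AEMeasurable N μ := aemeasurable_numZeros_trigVec hv ν hνne (by positivity)
  have hNint : ∫⁻ w, N w ∂μ
      = ENNReal.ofReal (Real.sqrt ((n : ℝ) ^ 2 + ((ℓ : ℝ) ^ 2 - 1) / 3)) := by
    rw [← two_mul_sqrt_mean_shiftedFreq hℓ0 hn]
    exact lintegral_numZeros_trigVec hv ν hνne (by positivity)
  have hNW : AEMeasurable (fun ω => N (W ω)) P :=
    AEMeasurable.comp_aemeasurable (g := N) (by rwa [hlaw.map_eq]) hlaw.aemeasurable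
  have hae : (fun ω => numZeros (trigPoly n (fun i => a i ω) (fun i => b i ω))
      (Set.Ioo 0 (2 * Real.pi))) =ᵐ[P] fun ω => ((ℓ * m - ℓ : ℕ) : ℝ≥0∞) + N (W ω) := by
    filter_upwards [hgridΩ, ha_per, hb_per] with ω hω haω hbω
    have hmod : ∀ k (j : Fin ℓ), (ℓ * k + j) % ℓ = j := fun k j => by
      rw [Nat.mul_add_mod, Nat.mod_eq_of_lt j.2]
    refine numZeros_trigPoly_eq hℓ0 hm0 hn (fun k j hkj => ?_) (fun k j hkj => ?_) hω
    · have := haω.eq_mod hℓ _ hkj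
      simp only [hmod] at this
      exact this
    · have := hbω.eq_mod hℓ _ hkj
      simp only [hmod] at this
      exact this
  refine ⟨(hNW.const_add _).congr hae.symm, ?_⟩
  have hcount : ((ℓ * m - ℓ : ℕ) : ℝ) = (n : ℝ) + 1 - ℓ := by
    rw [← hn, Nat.cast_sub (hn ▸ Nat.le_mul_of_pos_right ℓ hm0)]
    push_cast
    ring
  rw [MeasureTheory.lintegral_congr_ae hae,
    MeasureTheory.lintegral_add_left measurable_const, MeasureTheory.lintegral_const,
    MeasureTheory.measure_univ, mul_one, hlaw.lintegral_comp hNm, hNint, ← hcount,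
    ENNReal.ofReal_add (Nat.cast_nonneg _) (Real.sqrt_nonneg _), ENNReal.ofReal_natCast]
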